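/- Conventions. A stereotype space is a Hausdorff locally convex space $X$ over $\mathbb{C}$ for which the natural map $X\to X^{\star\star}$ is an isomorphism of topological vector spaces, where $X^\star$ is the space of continuous linear functionals with the topology of uniform convergence on totally bounded sets. A stereotype algebra is a stereotype space $A$ with an associative unital multiplication such that for every totally bounded $K\subseteq A$ and every neighbourhood $U$ of $0$ there is a neighbourhood $V$ of $0$ with $K\cdot V\subseteq U$ and $V\cdot K\subseteq U$; a left stereotype $A$-module is a stereotype space $X$ with a unital left $A$-module structure whose action $A\times X\to X$ is continuous in the same sense (for totally bounded subsets of $A$ and of $X$). For a locally convex space $E$, its pseudocompletion $E^\triangledown$ is the least subspace of the completion of $E$ that contains the image of $E$ and in which every totally bounded Cauchy net converges. Let $A$ be an involutive stereotype algebra, that is, a (not necessarily commutative) stereotype algebra with a continuous involution. Let $\mathrm{Spec}(A)$ be the set of continuous unital involutive characters $t:A\to\mathbb{C}$, with the topology of uniform convergence on totally bounded sets, and let $I_t=\ker t$. For a left stereotype $A$-module $X$ and $n\ge 0$ put $$J^n_t(X)=\big(X/\overline{I_t^{n+1}\cdot X}\big)^\triangledown,\qquad J^n_A(X)=\bigsqcup_{t\in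 \mathrm{Spec}(A)}J^n_t(X),\qquad j^n(x)(t)=x+\overline{I_t^{n+1}\cdot X}\quad(x\in X),$$ where $I_t^{n+1}\cdot X$ is the linear span of all $a_1\cdots a_{n+1}\cdot x$ with $a_i\in I_t$, $x\in X$. Let $\pi:J^n_A(X)\to\mathrm{Spec}(A)$ be the projection. For a continuous seminorm $p$ on $X$ let $p^n_t$ be the extension by continuity to $J^n_t(X)$ of the quotient seminorm $x+\overline{I_t^{n+1}\cdot X}\mapsto\inf\{p(x+y): y\in\overline{I_t^{n+1}\cdot X}\}$. The set $J^n_A(X)$ carries the topology generated by the sets $$W(x,U,p,\varepsilon)=\{\xi:\ \pi(\xi)\in U,\ p^n_{\pi(\xi)}\big(\xi-j^n(x)(\pi(\xi))\big)<\varepsilon\},$$ with $x\in X$, $U\subseteq\mathrm{Spec}(A)$ open, $p$ a continuous seminorm on $X$ and $\varepsilon>0$. Theorem. Let $X,Y$ be left stereotype modules over an involutive stereotype algebra $A$, let $n\ge 0$, and let $D:X\to Y$ be a differential operator of order at most $n$, that is, a continuous $\mathbb{C}$-linear map with $[\dots[[D,a_0],a_1],\dots,a_n]=0$ for all $a_0,\dots,a_n\in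 A$, where $[P,a](x)=P(a\cdot x)-a\cdot P(x)$. Then there is a morphism of bundles $j_n[D]:J^n_A(X)\to J^0_A(Y)$, that is, a continuous map which for every $t\in\mathrm{Spec}(A)$ maps the fiber $J^n_t(X)$ into the fiber $J^0_t(Y)$, $\mathbb{C}$-linearly, such that $$j^0(Dx)=j_n[D]\circ j^n(x)\qquad\text{for all }x\in X.$$ -/

import Mathlib

open Set Filter Topology UniformSpace Uniformity

/-! ## Stereotype spaces, algebras and modules -/

/-- The dual space `X⋆` of continuous linear functionals, with the topology of uniform convergence
on totally bounded subsets of `X`. -/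
abbrev StereotypeDual (X : Type*) [AddCommGroup X] [Module ℂ X] [UniformSpace X] : Type _ :=
  UniformConvergenceCLM (RingHom.id ℂ) (E := X) ℂ {S : Set X | TotallyBounded S}

/-- A stereotype space: a Hausdorff locally convex space over `ℂ` for which the natural map
`x ↦ (f ↦ f x)` is an isomorphism of topological vector spaces from `X` onto `X⋆⋆`. -/
structure IsStereotypeSpace (X : Type*) [AddCommGroup X] [Module ℂ X] [UniformSpace X] : Prop where
  isUniformAddGroup : IsUniformAddGroup X
  continuousSMul : ContinuousSMul ℂ X
  locallyConvexSpace : LocallyConvexSpace ℝ X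
  t2Space : T2Space X
  reflexive : ∃ e : X ≃L[ℂ] StereotypeDual (StereotypeDual X),
    ∀ (x : X) (f : StereotypeDual X), e x f = f x

/-- A (unital, associative, not necessarily commutative) stereotype algebra: the multiplication is
continuous in the sense of stereotype spaces, that is, `K · V ⊆ U` and `V · K ⊆ U` for every totally
bounded `K`, every neighbourhood `U` of zero, and some neighbourhood `V` of zero. -/
structure IsStereotypeAlgebra (A : Type*) [Ring A] [Algebra ℂ A] [UniformSpace A] : Prop where
  isStereotypeSpace : IsStereotypeSpace A
  mul_continuous : ∀ K : Set A, TotallyBounded K → ∀ U ∈ 𝓝 (0 : A), ∃ V ∈ 𝓝 (0 : A),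
    ∀ a ∈ K, ∀ b ∈ V, a * b ∈ U ∧ b * a ∈ U

/-- A stereotype algebra with a continuous involution. -/
structure IsInvolutiveStereotypeAlgebra (A : Type*) [Ring A] [StarRing A] [Algebra ℂ A]
    [StarModule ℂ A] [UniformSpace A] : Prop where
  isStereotypeAlgebra : IsStereotypeAlgebra A
  continuous_star : Continuous (star : A → A)

/-- A left stereotype module `X` over `A`: the action `A × X → X` is continuous in the sense of
stereotype spaces. -/
structure IsStereotypeModule (A X : Type*) [Ring A] [Algebra ℂ A] [UniformSpace A]
    [AddCommGroup X] [Module ℂ X] [Module A X] [IsScalarTower ℂ A X] [UniformSpace X] : Prop where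
  isStereotypeSpace : IsStereotypeSpace X
  smul_continuous_right : ∀ K : Set A, TotallyBounded K → ∀ U ∈ 𝓝 (0 : X), ∃ V ∈ 𝓝 (0 : X),
    ∀ a ∈ K, ∀ x ∈ V, a • x ∈ U
  smul_continuous_left : ∀ K : Set X, TotallyBounded K → ∀ U ∈ 𝓝 (0 : X), ∃ V ∈ 𝓝 (0 : A),
    ∀ a ∈ V, ∀ x ∈ K, a • x ∈ U

/-! ## The involutive spectrum -/

/-- The involutive spectrum of `A`: continuous unital involutive characters `A → ℂ`. -/
def InvolutiveSpec (A : Type*) [Ring A] [StarRing A] [Algebra ℂ A] [TopologicalSpace A] : Type _ :=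
  {t : A →⋆ₐ[ℂ] ℂ // Continuous t}

/-- The value `t(a)` of a character. -/
noncomputable def InvolutiveSpec.eval {A : Type*} [Ring A] [StarRing A] [Algebra ℂ A] [TopologicalSpace A]
    (t : InvolutiveSpec A) (a : A) : ℂ := t.1 a

/-- The spectrum carries the topology of uniform convergence on totally bounded sets of `A`. -/
noncomputable instance InvolutiveSpec.instTopologicalSpace {A : Type*} [Ring A] [StarRing A] [Algebra ℂ A]
    [UniformSpace A] : TopologicalSpace (InvolutiveSpec A) :=
  TopologicalSpace.induced
    (fun t => UniformOnFun.ofFun {S : Set A | TotallyBounded S} t.eval) inferInstance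

/-! ## Pseudocompletion -/

/-- Every totally bounded Cauchy filter (net) in `S` converges to a point of `S`. -/
def IsPseudocompleteSet {E : Type*} [UniformSpace E] (S : Set E) : Prop :=
  ∀ F : Filter E, Cauchy F → (∃ T ∈ F, TotallyBounded T ∧ T ⊆ S) → ∃ x ∈ S, F ≤ 𝓝 x

/-- The pseudocompletion `E^▽` of a topological vector space `E`: the least pseudocomplete
subspace of the completion of `E` that contains (the image of) `E`. -/
noncomputable def pseudocompletion (E : Type*) [AddCommGroup E] [Module ℂ E] [UniformSpace E]
    [IsUniformAddGroup E] [UniformContinuousConstSMul ℂ E] : Submodule ℂ (Completion E) :=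
  sInf {P | (∀ e : E, (e : Completion E) ∈ P) ∧ IsPseudocompleteSet (P : Set (Completion E))}

theorem coe_mem_pseudocompletion {E : Type*} [AddCommGroup E] [Module ℂ E] [UniformSpace E]
    [IsUniformAddGroup E] [UniformContinuousConstSMul ℂ E] (e : E) :
    (e : Completion E) ∈ pseudocompletion E :=
  (Submodule.mem_sInf).2 fun _ hP => hP.1 e

/-! ## Quotients of topological vector spaces -/

section Quotient

variable {X : Type*} [AddCommGroup X] [Module ℂ X] [UniformSpace X] [IsUniformAddGroup X]

/-- The group uniformity of the quotient topology. -/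
instance Submodule.quotientUniformSpace (N : Submodule ℂ X) : UniformSpace (X ⧸ N) :=
  IsTopologicalAddGroup.rightUniformSpace (X ⧸ N)

instance Submodule.quotient_isUniformAddGroup (N : Submodule ℂ X) : IsUniformAddGroup (X ⧸ N) :=
  isUniformAddGroup_of_addCommGroup

instance Submodule.quotient_uniformContinuousConstSMul [ContinuousSMul ℂ X] (N : Submodule ℂ X) :
    UniformContinuousConstSMul ℂ (X ⧸ N) :=
  uniformContinuousConstSMul_of_continuousConstSMul ℂ (X ⧸ N)

/-- The quotient seminorm `x + N ↦ inf_{y ∈ N} p (x + y)`. -/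
noncomputable def quotientSeminorm (N : Submodule ℂ X) (p : Seminorm ℂ X) (q : X ⧸ N) : ℝ :=
  sInf (p '' {x : X | N.mkQ x = q})

theorem quotientSeminorm_mkQ_le (N : Submodule ℂ X) (p : Seminorm ℂ X) (x : X) :
    quotientSeminorm N p (N.mkQ x) ≤ p x :=
  csInf_le ⟨0, by rintro _ ⟨y, -, rfl⟩; exact apply_nonneg p y⟩ ⟨x, rfl, rfl⟩

theorem quotientSeminorm_le_add (N : Submodule ℂ X) (p : Seminorm ℂ X) (q r : X ⧸ N) :
    quotientSeminorm N p q ≤ quotientSeminorm N p r + quotientSeminorm N p (q - r) := by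
  have hne : ∀ s : X ⧸ N, (p '' {x : X | N.mkQ x = s}).Nonempty := fun s =>
    (N.mkQ_surjective s).elim fun x hx => ⟨p x, x, hx, rfl⟩
  refine le_of_forall_pos_lt_add fun ε hε => ?_
  obtain ⟨_, ⟨x, hx, rfl⟩, hx'⟩ := Real.lt_sInf_add_pos (hne r) (half_pos hε)
  obtain ⟨_, ⟨y, hy, rfl⟩, hy'⟩ := Real.lt_sInf_add_pos (hne (q - r)) (half_pos hε)
  have hxy : N.mkQ (x + y) = q := by
    rw [map_add, show N.mkQ x = r from hx, show N.mkQ y = q - r from hy]; abel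
  have h1 := quotientSeminorm_mkQ_le N p (x + y)
  have h2 := map_add_le_add p x y
  rw [hxy] at h1
  change p x < quotientSeminorm N p r + ε / 2 at hx'
  change p y < quotientSeminorm N p (q - r) + ε / 2 at hy'
  linarith

theorem uniformContinuous_quotientSeminorm (N : Submodule ℂ X) {p : Seminorm ℂ X}
    (hp : Continuous p) : UniformContinuous (quotientSeminorm N p) := by
  have h0 : ∀ ε > 0, ∀ᶠ q in 𝓝 (0 : X ⧸ N), quotientSeminorm N p q < ε := by
    intro ε hε
    have hopen : IsOpen (N.mkQ '' {x : X | p x < ε}) :=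
      N.isOpenMap_mkQ _ (isOpen_lt hp continuous_const)
    refine mem_of_superset (hopen.mem_nhds ⟨0, by simpa using hε, map_zero _⟩) ?_
    rintro _ ⟨x, hx, rfl⟩
    exact (quotientSeminorm_mkQ_le N p x).trans_lt hx
  have key : Tendsto (fun z : (X ⧸ N) × (X ⧸ N) => z.2 - z.1) (𝓤 (X ⧸ N)) (𝓝 0) := by
    rw [uniformity_eq_comap_nhds_zero]
    exact tendsto_comap
  have key' : Tendsto (fun z : (X ⧸ N) × (X ⧸ N) => z.1 - z.2) (𝓤 (X ⧸ N)) (𝓝 0) := by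
    simpa using key.neg
  refine Metric.uniformity_basis_dist.tendsto_right_iff.2 fun ε hε => ?_
  filter_upwards [key (h0 ε hε), key' (h0 ε hε)] with z h1 h2
  change quotientSeminorm N p (z.2 - z.1) < ε at h1
  change quotientSeminorm N p (z.1 - z.2) < ε at h2
  have h3 := quotientSeminorm_le_add N p z.1 z.2
  have h4 := quotientSeminorm_le_add N p z.2 z.1
  change dist _ _ < ε
  rw [Real.dist_eq, abs_lt]
  constructor <;> linarith

/-- The extension by continuity of the quotient seminorm to the completion of `X ⧸ N`. -/
noncomputable def completedQuotientSeminorm (N : Submodule ℂ X) (p : Seminorm ℂ X) :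
    Completion (X ⧸ N) → ℝ :=
  Completion.extension (quotientSeminorm N p)

theorem completedQuotientSeminorm_coe (N : Submodule ℂ X) {p : Seminorm ℂ X} (hp : Continuous p)
    (q : X ⧸ N) : completedQuotientSeminorm N p (q : Completion (X ⧸ N)) = quotientSeminorm N p q :=
  Completion.extension_coe (uniformContinuous_quotientSeminorm N hp) q

end Quotient

/-! ## Jet bundles -/

section Jets

variable {A : Type*} [Ring A] [StarRing A] [Algebra ℂ A] [UniformSpace A]

/-- The subspace `I_t ^ k · X` of `X`, where `I_t` is the kernel of the character `t`: the span of
all `a₁ ⋯ a_k · x` with `a₁, …, a_k ∈ I_t` and `x ∈ X`. -/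
def kerPowSMul (X : Type*) [AddCommGroup X] [Module ℂ X] [Module A X] (k : ℕ)
    (t : InvolutiveSpec A) : Submodule ℂ X :=
  Submodule.span ℂ {y | ∃ (l : List A) (x : X),
    l.length = k ∧ (∀ a ∈ l, t.eval a = 0) ∧ y = l.prod • x}

variable (X : Type*) [AddCommGroup X] [Module ℂ X] [Module A X] [UniformSpace X]
  [IsUniformAddGroup X] [ContinuousSMul ℂ X]

/-- The closure of `I_t ^ (n + 1) · X`. -/
def jetKernel (n : ℕ) (t : InvolutiveSpec A) : Submodule ℂ X :=
  (kerPowSMul X (n + 1) t).topologicalClosure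

/-- The space of jets of order `n` of `X` at `t`: the pseudocompletion of the quotient of `X`
by the closure of `I_t ^ (n + 1) · X`. -/
abbrev JetFiber (n : ℕ) (t : InvolutiveSpec A) : Type _ :=
  pseudocompletion (X ⧸ jetKernel X n t)

/-- The total space of the bundle of jets of order `n` of the `A`-module `X`: the disjoint union of
the fibers over the spectrum of `A`. -/
structure JetBundle (A : Type*) [Ring A] [StarRing A] [Algebra ℂ A] [UniformSpace A]
    (X : Type*) [AddCommGroup X] [Module ℂ X] [Module A X] [UniformSpace X]
    [IsUniformAddGroup X] [ContinuousSMul ℂ X] (n : ℕ) where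
  /-- The projection to the base. -/
  proj : InvolutiveSpec A
  /-- The point of the fiber. -/
  val : JetFiber X n proj

variable {X}

/-- The class of `x` in the space of jets of order `n` at `t`. -/
noncomputable def jetAt (n : ℕ) (t : InvolutiveSpec A) (x : X) : JetFiber X n t :=
  ⟨((jetKernel X n t).mkQ x : Completion (X ⧸ jetKernel X n t)), coe_mem_pseudocompletion _⟩

/-- The section `j^n(x)` of the jet bundle. -/
noncomputable def jet (A : Type*) [Ring A] [StarRing A] [Algebra ℂ A] [UniformSpace A]
    {X : Type*} [AddCommGroup X] [Module ℂ X] [Module A X] [UniformSpace X]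
    [IsUniformAddGroup X] [ContinuousSMul ℂ X] (n : ℕ) (x : X) (t : InvolutiveSpec A) :
    JetBundle A X n :=
  ⟨t, jetAt n t x⟩

/-- The seminorm `p^n_t` on the space of jets at `t` determined by a continuous seminorm `p`
on `X`. -/
noncomputable def jetSeminorm (n : ℕ) (t : InvolutiveSpec A) (p : Seminorm ℂ X)
    (ξ : JetFiber X n t) : ℝ :=
  completedQuotientSeminorm (jetKernel X n t) p ξ

/-- The basic open set `W(x, U, p, ε)` of the jet bundle. -/
def jetNhd (n : ℕ) (x : X) (U : Set (InvolutiveSpec A)) (p : Seminorm ℂ X) (ε : ℝ) :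
    Set (JetBundle A X n) :=
  {ξ | ξ.proj ∈ U ∧ jetSeminorm n ξ.proj p (ξ.val - jetAt n ξ.proj x) < ε}

/-- The topology of the jet bundle, generated by the sets `W(x, U, p, ε)` with `x ∈ X`, `U` open,
`p` a continuous seminorm on `X` and `ε > 0`. -/
instance JetBundle.instTopologicalSpace (n : ℕ) : TopologicalSpace (JetBundle A X n) :=
  TopologicalSpace.generateFrom
    {W | ∃ (x : X) (U : Set (InvolutiveSpec A)) (p : Seminorm ℂ X) (ε : ℝ),
      IsOpen U ∧ Continuous p ∧ 0 < ε ∧ W = jetNhd n x U p ε}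

variable {Y : Type*} [AddCommGroup Y] [Module ℂ Y] [Module A Y] [UniformSpace Y]
  [IsUniformAddGroup Y] [ContinuousSMul ℂ Y]

/-- A morphism of jet bundles over the spectrum of `A`: a continuous map of the total spaces that
maps each fiber to the fiber over the same point, linearly over `ℂ`. -/
def IsJetBundleMorphism {n m : ℕ} (μ : JetBundle A X n → JetBundle A Y m) : Prop :=
  Continuous μ ∧ ∃ φ : ∀ t : InvolutiveSpec A, JetFiber X n t →ₗ[ℂ] JetFiber Y m t,
    ∀ (t : InvolutiveSpec A) (ξ : JetFiber X n t), μ ⟨t, ξ⟩ = ⟨t, φ t ξ⟩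

end Jets

/-! ## Differential operators -/

/-- The commutator `[P, a] : x ↦ P (a · x) - a · P x`. -/
def moduleCommutator {A X Y : Type*} [SMul A X] [AddCommGroup Y] [SMul A Y]
    (P : X → Y) (a : A) : X → Y :=
  fun x => P (a • x) - a • P x

/-- `D` is a differential operator of order at most `n` between the `A`-modules `X` and `Y`: it is
a continuous linear map, and `[… [D, a₀], … aₙ] = 0` for all `a₀, …, aₙ ∈ A`. -/
def IsDiffOp (A : Type*) {X Y : Type*} [Ring A] [AddCommGroup X] [Module ℂ X] [Module A X]
    [TopologicalSpace X] [AddCommGroup Y] [Module ℂ Y] [Module A Y] [TopologicalSpace Y]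
    (n : ℕ) (D : X →L[ℂ] Y) : Prop :=
  ∀ l : List A, l.length = n + 1 → l.foldl moduleCommutator (D : X → Y) = 0

/-!
Modulo `I_t ^ k · Y`, an operator of order at most `n` kills `I_t ^ (n + k) · X`: moving one factor
`a ∈ I_t` through `P` by `P ∘ a = a ∘ P + [P, a]` either leaves a factor `a` in front or lowers the
order. Hence `D` induces continuous maps of the quotients, and, pseudocompletion being a functor,
linear maps of the fibers, which satisfy `q_t (φ_t ξ) ≤ (q ∘ D)_t ξ`.

Continuity of the total map requires in addition that `t ↦ q_t (j^k y t)` be upper semicontinuous.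
This holds because every element of `I_t₀ ^ k · Y` extends to a continuous family of elements of
`I_t ^ k · Y`: replace each factor `a ∈ I_t₀` by `a - t a`.
-/

section Pseudocompletion

theorem IsPseudocompleteSet.preimage {α β : Type*} [UniformSpace α] [CompleteSpace α]
    [UniformSpace β] [T2Space β] {f : α → β} (hf : UniformContinuous f) {S : Set β}
    (hS : IsPseudocompleteSet S) : IsPseudocompleteSet (f ⁻¹' S) := by
  rintro G hG ⟨T, hTG, hT, hTS⟩
  obtain ⟨x, hx⟩ := CompleteSpace.complete hG
  obtain ⟨y, hy, hGy⟩ := hS (map f G) (hG.map hf)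
    ⟨f '' T, image_mem_map hTG, hT.image hf, image_subset_iff.2 hTS⟩
  have := hG.1
  have hfxy : f x = y :=
    tendsto_nhds_unique ((hf.continuous.tendsto x).mono_left hx) hGy
  exact ⟨x, mem_preimage.2 (hfxy ▸ hy), hx⟩

variable {E F : Type*} [AddCommGroup E] [Module ℂ E] [UniformSpace E] [IsUniformAddGroup E]
  [UniformContinuousConstSMul ℂ E] [AddCommGroup F] [Module ℂ F] [UniformSpace F]
  [IsUniformAddGroup F] [UniformContinuousConstSMul ℂ F]

theorem isPseudocompleteSet_pseudocompletion :
    IsPseudocompleteSet (pseudocompletion E : Set (Completion E)) := by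
  rintro G hG ⟨T, hTG, hT, hTS⟩
  obtain ⟨x, hx⟩ := CompleteSpace.complete hG
  have := hG.1
  refine ⟨x, Submodule.mem_sInf.2 fun P hP => ?_, hx⟩
  obtain ⟨z, hz, hGz⟩ := hP.2 G hG ⟨T, hTG, hT, fun y hy => Submodule.mem_sInf.1 (hTS hy) P hP⟩
  exact tendsto_nhds_unique hx hGz ▸ hz

theorem completion_mem_pseudocompletion (f : E →L[ℂ] F) {ξ : Completion E}
    (hξ : ξ ∈ pseudocompletion E) : f.completion ξ ∈ pseudocompletion F := by
  refine Submodule.mem_sInf.1 hξ ((pseudocompletion F).comap f.completion.toLinearMap)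
    ⟨fun e => ?_, isPseudocompleteSet_pseudocompletion.preimage f.completion.uniformContinuous⟩
  change f.completion e ∈ pseudocompletion F
  rw [ContinuousLinearMap.completion_apply_coe]
  exact coe_mem_pseudocompletion _

/-- The linear map of pseudocompletions induced by a continuous linear map, obtained by restricting
its extension to the completions. -/
noncomputable def pseudocompletionMap (f : E →L[ℂ] F) :
    pseudocompletion E →ₗ[ℂ] pseudocompletion F :=
  f.completion.toLinearMap.restrict fun _ => completion_mem_pseudocompletion f

end Pseudocompletion

section QuotientSeminorm

theorem le_quotientSeminorm {X : Type*} [AddCommGroup X] [Module ℂ X] {N : Submodule ℂ X}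
    {p : Seminorm ℂ X} {c : ℝ} {r : X ⧸ N} (h : ∀ x, N.mkQ x = r → c ≤ p x) :
    c ≤ quotientSeminorm N p r := by
  refine le_csInf ((N.mkQ_surjective r).elim fun x hx => ⟨_, x, hx, rfl⟩) ?_
  rintro _ ⟨x, hx, rfl⟩
  exact h x hx

theorem quotientSeminorm_mapQ_le {X Y : Type*} [AddCommGroup X] [Module ℂ X] [AddCommGroup Y]
    [Module ℂ Y] [UniformSpace Y] [IsUniformAddGroup Y] {N : Submodule ℂ X} {M : Submodule ℂ Y}
    (T : X →ₗ[ℂ] Y) (h : N ≤ M.comap T) (q : Seminorm ℂ Y) (r : X ⧸ N) :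
    quotientSeminorm M q (N.mapQ M T h r) ≤ quotientSeminorm N (q.comp T) r := by
  refine le_quotientSeminorm ?_
  rintro x rfl
  exact quotientSeminorm_mkQ_le M q (T x)

variable {X : Type*} [AddCommGroup X] [Module ℂ X] [UniformSpace X] [IsUniformAddGroup X]

theorem quotientSeminorm_zero (N : Submodule ℂ X) (p : Seminorm ℂ X) :
    quotientSeminorm N p 0 = 0 :=
  le_antisymm (by simpa using quotientSeminorm_mkQ_le N p 0)
    (le_quotientSeminorm fun x _ => apply_nonneg p x)

theorem quotientSeminorm_neg (N : Submodule ℂ X) (p : Seminorm ℂ X) (r : X ⧸ N) :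
    quotientSeminorm N p (-r) = quotientSeminorm N p r := by
  have hle (r : X ⧸ N) : quotientSeminorm N p (-r) ≤ quotientSeminorm N p r := by
    refine le_quotientSeminorm ?_
    rintro x rfl
    simpa using quotientSeminorm_mkQ_le N p (-x)
  exact le_antisymm (hle r) (by simpa using hle (-r))

theorem quotientSeminorm_mkQ_lt_iff (N : Submodule ℂ X) (p : Seminorm ℂ X) (x : X) (c : ℝ) :
    quotientSeminorm N p (N.mkQ x) < c ↔ ∃ z ∈ N, p (x + z) < c := by
  constructor
  · contrapose!
    refine fun h => le_quotientSeminorm fun w hw => ?_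
    simpa using h (w - x) ((Submodule.Quotient.eq N).1 hw)
  · rintro ⟨z, hz, hzc⟩
    have hxz : N.mkQ (x + z) = N.mkQ x := (Submodule.Quotient.eq N).2 (by simpa using hz)
    exact hxz ▸ (quotientSeminorm_mkQ_le N p (x + z)).trans_lt hzc

theorem quotientSeminorm_topologicalClosure_lt_iff [ContinuousSMul ℂ X] (N : Submodule ℂ X)
    {p : Seminorm ℂ X} (hp : Continuous p) (x : X) (c : ℝ) :
    quotientSeminorm N.topologicalClosure p (N.topologicalClosure.mkQ x) < c ↔
      ∃ z ∈ N, p (x + z) < c := by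
  have hopen : IsOpen {z | p (x + z) < c} := isOpen_lt (by fun_prop) continuous_const
  rw [quotientSeminorm_mkQ_lt_iff]
  exact closure_inter_open_nonempty_iff hopen

theorem continuous_completedQuotientSeminorm (N : Submodule ℂ X) (p : Seminorm ℂ X) :
    Continuous (completedQuotientSeminorm N p) :=
  Completion.continuous_extension

theorem completedQuotientSeminorm_zero (N : Submodule ℂ X) {p : Seminorm ℂ X}
    (hp : Continuous p) : completedQuotientSeminorm N p 0 = 0 := by
  rw [← Completion.coe_zero, completedQuotientSeminorm_coe N hp, quotientSeminorm_zero]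

theorem completedQuotientSeminorm_sub_comm (N : Submodule ℂ X) {p : Seminorm ℂ X}
    (hp : Continuous p) (ξ η : Completion (X ⧸ N)) :
    completedQuotientSeminorm N p (ξ - η) = completedQuotientSeminorm N p (η - ξ) := by
  have hc := continuous_completedQuotientSeminorm N p
  refine Completion.induction_on₂ ξ η (isClosed_eq (by fun_prop) (by fun_prop)) fun r s => ?_
  simp only [← Completion.coe_sub, completedQuotientSeminorm_coe N hp]
  rw [← neg_sub, quotientSeminorm_neg]

theorem completedQuotientSeminorm_sub_le (N : Submodule ℂ X) {p : Seminorm ℂ X}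
    (hp : Continuous p) (ξ η ζ : Completion (X ⧸ N)) :
    completedQuotientSeminorm N p (ξ - ζ) ≤
      completedQuotientSeminorm N p (ξ - η) + completedQuotientSeminorm N p (η - ζ) := by
  have hc := continuous_completedQuotientSeminorm N p
  refine Completion.induction_on₃ ξ η ζ (isClosed_le (by fun_prop) (by fun_prop)) fun r s u => ?_
  simp only [← Completion.coe_sub, completedQuotientSeminorm_coe N hp]
  simpa only [sub_sub_sub_cancel_left] using quotientSeminorm_le_add N p (r - u) (r - s)

theorem exists_completedQuotientSeminorm_sub_mkQ_lt (N : Submodule ℂ X) {p : Seminorm ℂ X}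
    (hp : Continuous p) (ξ : Completion (X ⧸ N)) {ε : ℝ} (hε : 0 < ε) :
    ∃ x : X, completedQuotientSeminorm N p (ξ - (N.mkQ x : Completion (X ⧸ N))) < ε := by
  have hc := continuous_completedQuotientSeminorm N p
  have hopen : IsOpen {η | completedQuotientSeminorm N p (ξ - η) < ε} :=
    isOpen_lt (by fun_prop) continuous_const
  have hξ : completedQuotientSeminorm N p (ξ - ξ) < ε := by
    rw [sub_self]
    exact (completedQuotientSeminorm_zero N hp).trans_lt hε
  obtain ⟨r, hr⟩ := Completion.denseRange_coe.exists_mem_open hopen ⟨ξ, hξ⟩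
  obtain ⟨x, rfl⟩ := N.mkQ_surjective r
  exact ⟨x, hr⟩

variable {Y : Type*} [AddCommGroup Y] [Module ℂ Y] [UniformSpace Y] [IsUniformAddGroup Y]

/-- The continuous linear map of quotients induced by a continuous linear map; the continuous
counterpart of `Submodule.mapQ`. -/
def quotientMapL {N : Submodule ℂ X} {M : Submodule ℂ Y} (T : X →L[ℂ] Y)
    (h : N ≤ M.comap T.toLinearMap) : (X ⧸ N) →L[ℂ] (Y ⧸ M) where
  toLinearMap := N.mapQ M T.toLinearMap h
  cont := N.isQuotientMap_mkQL.continuous_iff.2 (M.mkQL.continuous.comp T.continuous)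

theorem completedQuotientSeminorm_completion_quotientMapL_le [ContinuousSMul ℂ X]
    [ContinuousSMul ℂ Y] {N : Submodule ℂ X} {M : Submodule ℂ Y} (T : X →L[ℂ] Y)
    (h : N ≤ M.comap T.toLinearMap) {q : Seminorm ℂ Y} (hq : Continuous q)
    (ξ : Completion (X ⧸ N)) :
    completedQuotientSeminorm M q ((quotientMapL T h).completion ξ) ≤
      completedQuotientSeminorm N (q.comp T.toLinearMap) ξ := by
  have hqT : Continuous (q.comp T.toLinearMap) := hq.comp T.continuous
  refine Completion.induction_on ξ (isClosed_le
    ((continuous_completedQuotientSeminorm M q).comp (quotientMapL T h).completion.continuous)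
    (continuous_completedQuotientSeminorm N _)) fun r => ?_
  rw [ContinuousLinearMap.completion_apply_coe, completedQuotientSeminorm_coe M hq,
    completedQuotientSeminorm_coe N hqT]
  exact quotientSeminorm_mapQ_le T.toLinearMap h q r

end QuotientSeminorm

section KernelPowers

theorem InvolutiveSpec.eval_sub_algebraMap_eval {A : Type*} [Ring A] [StarRing A] [Algebra ℂ A]
    [TopologicalSpace A] (t : InvolutiveSpec A) (a : A) :
    t.eval (a - algebraMap ℂ A (t.eval a)) = 0 := by
  simp only [eval, map_sub, AlgHomClass.commutes, Algebra.algebraMap_self, RingHom.id_apply,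
    sub_self]

variable {A : Type*} [Ring A] [StarRing A] [Algebra ℂ A] [UniformSpace A]

theorem InvolutiveSpec.continuous_eval_const (a : A) :
    Continuous fun t : InvolutiveSpec A => t.eval a :=
  (UniformOnFun.uniformContinuous_eval_of_mem ℂ {S : Set A | TotallyBounded S} (mem_singleton a)
    (totallyBounded_singleton a)).continuous.comp continuous_induced_dom

variable {Y : Type*} [AddCommGroup Y] [Module ℂ Y] [Module A Y]

theorem kerPowSMul_zero (t : InvolutiveSpec A) : kerPowSMul Y 0 t = ⊤ :=
  eq_top_iff.2 fun y _ => Submodule.subset_span ⟨[], y, rfl, by simp, by simp⟩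

variable [IsScalarTower ℂ A Y]

theorem smul_mem_kerPowSMul_succ {t : InvolutiveSpec A} {a : A} (ha : t.eval a = 0) {k : ℕ} {y : Y}
    (hy : y ∈ kerPowSMul Y k t) : a • y ∈ kerPowSMul Y (k + 1) t := by
  induction hy using Submodule.span_induction with
  | mem y hy =>
    obtain ⟨l, x, rfl, hlt, rfl⟩ := hy
    exact Submodule.subset_span
      ⟨a :: l, x, rfl, List.forall_mem_cons.2 ⟨ha, hlt⟩, by rw [List.prod_cons, mul_smul]⟩
  | zero => simp
  | add y z _ _ hy hz => simpa only [smul_add] using add_mem hy hz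
  | smul c y _ hy => simpa only [smul_comm a c y] using Submodule.smul_mem _ c hy

-- `m` is the order plus one, so that the induction starts at `P = 0`.
theorem apply_prod_smul_mem_kerPowSMul {X : Type*} [AddCommGroup X] [Module A X]
    (t : InvolutiveSpec A) {m k : ℕ} {P : X → Y}
    (hP : ∀ l : List A, l.length = m → l.foldl moduleCommutator P = 0) {l : List A}
    (hl : l.length + 1 = m + k) (hlt : ∀ a ∈ l, t.eval a = 0) (x : X) :
    P (l.prod • x) ∈ kerPowSMul Y k t := by
  induction m generalizing k P l with
  | zero =>
    rw [show P = 0 from hP [] rfl]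
    exact zero_mem _
  | succ m ih_order =>
    induction k generalizing l with
    | zero => simp [kerPowSMul_zero]
    | succ k ih_power =>
      obtain _ | ⟨a, l⟩ := l
      · grind
      rw [List.length_cons] at hl
      obtain ⟨ha, hlt⟩ := List.forall_mem_cons.1 hlt
      have hsmul : a • P (l.prod • x) ∈ kerPowSMul Y (k + 1) t :=
        smul_mem_kerPowSMul_succ ha (ih_power (by omega) hlt)
      have hcomm : moduleCommutator P a (l.prod • x) ∈ kerPowSMul Y (k + 1) t :=
        ih_order (fun l' hl' => hP (a :: l') (congrArg (· + 1) hl')) (by omega) hlt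
      simpa [moduleCommutator, mul_smul] using add_mem hsmul hcomm

-- The map `y ↦ a • y` need not be continuous. Carrying the left factor `b` through the induction
-- expands the product into fixed vectors whose coefficients are continuous in `t`.
theorem continuous_mul_prod_sub_eval_smul [TopologicalSpace Y] [IsTopologicalAddGroup Y]
    [ContinuousSMul ℂ Y] (b : A) (l : List A) (y : Y) :
    Continuous fun t : InvolutiveSpec A =>
      (b * (l.map fun a => a - algebraMap ℂ A (t.eval a)).prod) • y := by
  induction l generalizing b with
  | nil => simpa using continuous_const
  | cons a l ih =>
    have hexpand (t : InvolutiveSpec A) :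
        (b * ((a :: l).map fun a => a - algebraMap ℂ A (t.eval a)).prod) • y =
          (b * a * (l.map fun a => a - algebraMap ℂ A (t.eval a)).prod) • y -
            t.eval a • (b * (l.map fun a => a - algebraMap ℂ A (t.eval a)).prod) • y := by
      rw [List.map_cons, List.prod_cons, ← smul_assoc, ← sub_smul, sub_mul, mul_sub, mul_assoc,
        ← Algebra.smul_def, mul_smul_comm]
    simp only [hexpand]
    exact (ih (b * a)).sub ((InvolutiveSpec.continuous_eval_const a).smul (ih b))

theorem exists_continuous_forall_mem_kerPowSMul [TopologicalSpace Y] [IsTopologicalAddGroup Y]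
    [ContinuousSMul ℂ Y] {k : ℕ} (t₀ : InvolutiveSpec A) {z : Y} (hz : z ∈ kerPowSMul Y k t₀) :
    ∃ Z : InvolutiveSpec A → Y, Continuous Z ∧ Z t₀ = z ∧ ∀ t, Z t ∈ kerPowSMul Y k t := by
  induction hz using Submodule.span_induction with
  | mem z hz =>
    obtain ⟨l, y, rfl, hlt, rfl⟩ := hz
    refine ⟨fun t => (l.map fun a => a - algebraMap ℂ A (t.eval a)).prod • y,
      by simpa only [one_mul] using continuous_mul_prod_sub_eval_smul (1 : A) l y, ?_,
      fun t => Submodule.subset_span ⟨_, y, List.length_map _, ?_, rfl⟩⟩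
    · have hl : l.map (fun a => a - algebraMap ℂ A (t₀.eval a)) = l :=
        (List.map_congr_left fun a ha => by rw [hlt a ha, map_zero, sub_zero]).trans l.map_id'
      simp only [hl]
    · simp only [List.forall_mem_map, InvolutiveSpec.eval_sub_algebraMap_eval, implies_true]
  | zero => exact ⟨fun _ => 0, continuous_const, rfl, fun t => zero_mem _⟩
  | add z w _ _ hz hw =>
    obtain ⟨Z, hZ, rfl, hZt⟩ := hz
    obtain ⟨W, hW, rfl, hWt⟩ := hw
    exact ⟨fun t => Z t + W t, hZ.add hW, rfl, fun t => add_mem (hZt t) (hWt t)⟩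
  | smul c z _ hz =>
    obtain ⟨Z, hZ, rfl, hZt⟩ := hz
    exact ⟨fun t => c • Z t, hZ.const_smul c, rfl, fun t => Submodule.smul_mem _ c (hZt t)⟩

end KernelPowers

section JetMaps

variable {A X Y : Type*} [Ring A] [StarRing A] [Algebra ℂ A] [UniformSpace A]
  [AddCommGroup X] [Module ℂ X] [Module A X] [UniformSpace X] [IsUniformAddGroup X]
  [ContinuousSMul ℂ X] [AddCommGroup Y] [Module ℂ Y] [Module A Y] [UniformSpace Y]
  [IsUniformAddGroup Y] [ContinuousSMul ℂ Y] {m k : ℕ}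

theorem jetAt_sub (t : InvolutiveSpec A) (x y : X) :
    jetAt m t (x - y) = jetAt m t x - jetAt m t y :=
  Subtype.ext (by simp only [jetAt, map_sub, Completion.coe_sub, AddSubgroupClass.coe_sub])

theorem jetSeminorm_jetAt (t : InvolutiveSpec A) {p : Seminorm ℂ X} (hp : Continuous p) (x : X) :
    jetSeminorm m t p (jetAt m t x) =
      quotientSeminorm (jetKernel X m t) p ((jetKernel X m t).mkQ x) :=
  completedQuotientSeminorm_coe _ hp _

theorem jetSeminorm_sub_comm (t : InvolutiveSpec A) {p : Seminorm ℂ X} (hp : Continuous p)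
    (ξ η : JetFiber X m t) : jetSeminorm m t p (ξ - η) = jetSeminorm m t p (η - ξ) :=
  completedQuotientSeminorm_sub_comm _ hp _ _

theorem jetSeminorm_sub_le (t : InvolutiveSpec A) {p : Seminorm ℂ X} (hp : Continuous p)
    (ξ η ζ : JetFiber X m t) :
    jetSeminorm m t p (ξ - ζ) ≤ jetSeminorm m t p (ξ - η) + jetSeminorm m t p (η - ζ) :=
  completedQuotientSeminorm_sub_le _ hp _ _ _

theorem exists_jetSeminorm_sub_jetAt_lt (t : InvolutiveSpec A) {p : Seminorm ℂ X}
    (hp : Continuous p) (ξ : JetFiber X m t) {ε : ℝ} (hε : 0 < ε) :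
    ∃ x : X, jetSeminorm m t p (ξ - jetAt m t x) < ε :=
  exists_completedQuotientSeminorm_sub_mkQ_lt _ hp _ hε

theorem isOpen_jetNhd (x : X) {U : Set (InvolutiveSpec A)} (hU : IsOpen U) {p : Seminorm ℂ X}
    (hp : Continuous p) {ε : ℝ} (hε : 0 < ε) : IsOpen (jetNhd m x U p ε) :=
  TopologicalSpace.isOpen_generateFrom_of_mem ⟨x, U, p, ε, hU, hp, hε, rfl⟩

theorem upperSemicontinuous_jetSeminorm_jetAt [IsScalarTower ℂ A Y] {q : Seminorm ℂ Y}
    (hq : Continuous q) (y : Y) :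
    UpperSemicontinuous fun t : InvolutiveSpec A => jetSeminorm k t q (jetAt k t y) := by
  have hlt_iff (t : InvolutiveSpec A) (c : ℝ) :
      jetSeminorm k t q (jetAt k t y) < c ↔ ∃ z ∈ kerPowSMul Y (k + 1) t, q (y + z) < c := by
    rw [jetSeminorm_jetAt t hq]
    exact quotientSeminorm_topologicalClosure_lt_iff _ hq y c
  intro t₀ c ht₀
  obtain ⟨z, hz, hzc⟩ := (hlt_iff t₀ c).1 ht₀
  obtain ⟨Z, hZ, rfl, hZt⟩ := exists_continuous_forall_mem_kerPowSMul t₀ hz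
  have hopen : IsOpen {t | q (y + Z t) < c} := isOpen_lt (by fun_prop) continuous_const
  filter_upwards [hopen.mem_nhds hzc] with t ht
  exact (hlt_iff t c).2 ⟨Z t, hZt t, ht⟩

/-- The map of jets at `t` induced by a continuous linear map `T` that carries the kernel of the
jets of order `m` into the kernel of the jets of order `k`. -/
noncomputable def jetFiberMap (T : X →L[ℂ] Y) {t : InvolutiveSpec A}
    (h : jetKernel X m t ≤ (jetKernel Y k t).comap T.toLinearMap) :
    JetFiber X m t →ₗ[ℂ] JetFiber Y k t :=
  pseudocompletionMap (quotientMapL T h)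

theorem jetFiberMap_jetAt (T : X →L[ℂ] Y) {t : InvolutiveSpec A}
    (h : jetKernel X m t ≤ (jetKernel Y k t).comap T.toLinearMap) (x : X) :
    jetFiberMap T h (jetAt m t x) = jetAt k t (T x) :=
  Subtype.ext (ContinuousLinearMap.completion_apply_coe _ _)

theorem jetSeminorm_jetFiberMap_sub_jetAt_le (T : X →L[ℂ] Y) {t : InvolutiveSpec A}
    (h : jetKernel X m t ≤ (jetKernel Y k t).comap T.toLinearMap) {q : Seminorm ℂ Y}
    (hq : Continuous q) (ξ : JetFiber X m t) (x : X) :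
    jetSeminorm k t q (jetFiberMap T h ξ - jetAt k t (T x)) ≤
      jetSeminorm m t (q.comp T.toLinearMap) (ξ - jetAt m t x) := by
  rw [← jetFiberMap_jetAt T h, ← map_sub]
  exact completedQuotientSeminorm_completion_quotientMapL_le T h hq _

namespace JetBundle

variable (T : X →L[ℂ] Y)
  (h : ∀ t : InvolutiveSpec A, jetKernel X m t ≤ (jetKernel Y k t).comap T.toLinearMap)

/-- The map of total spaces induced by a continuous linear map `T` that carries the kernels of the
jets of order `m` into the kernels of the jets of order `k` at every point of the spectrum. -/
noncomputable def map (ξ : JetBundle A X m) : JetBundle A Y k :=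
  ⟨ξ.proj, jetFiberMap T (h ξ.proj) ξ.val⟩

theorem jetNhd_subset_preimage_map (x : X) (y : Y) (U : Set (InvolutiveSpec A)) {q : Seminorm ℂ Y}
    (hq : Continuous q) (δ ε : ℝ) :
    jetNhd m x (U ∩ {t | jetSeminorm k t q (jetAt k t (T x - y)) < ε - δ})
        (q.comp T.toLinearMap) δ ⊆
      map T h ⁻¹' jetNhd k y U q ε := by
  rintro ⟨t, ξ⟩ ⟨⟨htU, htxy : jetSeminorm k t q (jetAt k t (T x - y)) < ε - δ⟩,
    hξx : jetSeminorm m t (q.comp T.toLinearMap) (ξ - jetAt m t x) < δ⟩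
  refine ⟨htU, ?_⟩
  calc jetSeminorm k t q (jetFiberMap T (h t) ξ - jetAt k t y)
      ≤ jetSeminorm k t q (jetFiberMap T (h t) ξ - jetAt k t (T x)) +
          jetSeminorm k t q (jetAt k t (T x) - jetAt k t y) := jetSeminorm_sub_le t hq _ _ _
    _ ≤ jetSeminorm m t (q.comp T.toLinearMap) (ξ - jetAt m t x) +
          jetSeminorm k t q (jetAt k t (T x - y)) := by
        rw [jetAt_sub]
        gcongr
        exact jetSeminorm_jetFiberMap_sub_jetAt_le T (h t) hq ξ x
    _ < ε := by linarith

theorem exists_mem_jetNhd_of_map_mem_jetNhd {y : Y} {U : Set (InvolutiveSpec A)}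
    {q : Seminorm ℂ Y} (hq : Continuous q) {ε : ℝ} {ξ : JetBundle A X m}
    (hξ : map T h ξ ∈ jetNhd k y U q ε) :
    ∃ (x : X) (δ : ℝ), 0 < δ ∧
      ξ ∈ jetNhd m x (U ∩ {t | jetSeminorm k t q (jetAt k t (T x - y)) < ε - δ})
        (q.comp T.toLinearMap) δ := by
  obtain ⟨t, ξ⟩ := ξ
  obtain ⟨htU, hξy : jetSeminorm k t q (jetFiberMap T (h t) ξ - jetAt k t y) < ε⟩ := hξ
  obtain ⟨δ, hδ, hξδ⟩ : ∃ δ > 0,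
      jetSeminorm k t q (jetFiberMap T (h t) ξ - jetAt k t y) + δ < ε - δ :=
    ⟨(ε - jetSeminorm k t q (jetFiberMap T (h t) ξ - jetAt k t y)) / 3, by linarith, by linarith⟩
  obtain ⟨x, hξx⟩ :=
    exists_jetSeminorm_sub_jetAt_lt t (p := q.comp T.toLinearMap) (hq.comp T.continuous) ξ hδ
  refine ⟨x, δ, hδ, ⟨htU, ?_⟩, hξx⟩
  calc jetSeminorm k t q (jetAt k t (T x - y))
      ≤ jetSeminorm k t q (jetAt k t (T x) - jetFiberMap T (h t) ξ) +
          jetSeminorm k t q (jetFiberMap T (h t) ξ - jetAt k t y) := by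
        rw [jetAt_sub]
        exact jetSeminorm_sub_le t hq _ _ _
    _ ≤ δ + jetSeminorm k t q (jetFiberMap T (h t) ξ - jetAt k t y) := by
        rw [jetSeminorm_sub_comm t hq]
        gcongr
        exact (jetSeminorm_jetFiberMap_sub_jetAt_le T (h t) hq ξ x).trans hξx.le
    _ < ε - δ := by linarith

theorem continuous_map [IsScalarTower ℂ A Y] : Continuous (map T h) := by
  refine continuous_generateFrom_iff.2 ?_
  rintro _ ⟨y, U, q, ε, hU, hq, -, rfl⟩
  refine isOpen_iff_forall_mem_open.2 fun ξ hξ => ?_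
  obtain ⟨x, δ, hδ, hξx⟩ := exists_mem_jetNhd_of_map_mem_jetNhd T h hq hξ
  have hV := (upperSemicontinuous_jetSeminorm_jetAt (A := A) (k := k) hq (T x - y)).isOpen_preimage
    (ε - δ)
  exact ⟨_, jetNhd_subset_preimage_map T h x y U hq δ ε,
    isOpen_jetNhd x (hU.inter hV) (hq.comp T.continuous) hδ, hξx⟩

theorem isJetBundleMorphism_map [IsScalarTower ℂ A Y] : IsJetBundleMorphism (map T h) :=
  ⟨continuous_map T h, fun t => jetFiberMap T (h t), fun _ _ => rfl⟩

theorem map_comp_jet (x : X) : map T h ∘ jet A m x = jet A k (T x) :=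
  funext fun t => congrArg (JetBundle.mk t) (jetFiberMap_jetAt T (h t) x)

end JetBundle

theorem IsDiffOp.jetKernel_le_comap [IsScalarTower ℂ A Y] {n : ℕ} {D : X →L[ℂ] Y}
    (hD : IsDiffOp A n D) (k : ℕ) (t : InvolutiveSpec A) :
    jetKernel X (n + k) t ≤ (jetKernel Y k t).comap D.toLinearMap := by
  have hker : kerPowSMul X (n + k + 1) t ≤ (kerPowSMul Y (k + 1) t).comap D.toLinearMap := by
    refine Submodule.span_le.2 ?_
    rintro _ ⟨l, x, hl, hlt, rfl⟩
    exact apply_prod_smul_mem_kerPowSMul t hD (by omega) hlt x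
  exact Submodule.topologicalClosure_minimal _
    (hker.trans (Submodule.comap_mono (Submodule.le_topologicalClosure _)))
    ((Submodule.isClosed_topologicalClosure _).preimage D.continuous)

end JetMaps

theorem mainTheorem8_general {A X Y : Type*}
    [Ring A] [StarRing A] [Algebra ℂ A] [UniformSpace A]
    [AddCommGroup X] [Module ℂ X] [Module A X]
    [UniformSpace X] [IsUniformAddGroup X] [ContinuousSMul ℂ X]
    [AddCommGroup Y] [Module ℂ Y] [Module A Y] [IsScalarTower ℂ A Y]
    [UniformSpace Y] [IsUniformAddGroup Y] [ContinuousSMul ℂ Y]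
    (n k : ℕ) (D : X →L[ℂ] Y) (hD : IsDiffOp A n D) :
    ∃ μ : JetBundle A X (n + k) → JetBundle A Y k,
      IsJetBundleMorphism μ ∧ ∀ x : X, jet A k (D x) = μ ∘ jet A (n + k) x :=
  ⟨JetBundle.map D (hD.jetKernel_le_comap k), JetBundle.isJetBundleMorphism_map D _,
    fun x => (JetBundle.map_comp_jet D _ x).symm⟩

theorem mainTheorem8 {A X Y : Type*}
    [Ring A] [StarRing A] [Algebra ℂ A] [StarModule ℂ A] [UniformSpace A]
    [AddCommGroup X] [Module ℂ X] [Module A X] [IsScalarTower ℂ A X]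
    [UniformSpace X] [IsUniformAddGroup X] [ContinuousSMul ℂ X]
    [AddCommGroup Y] [Module ℂ Y] [Module A Y] [IsScalarTower ℂ A Y]
    [UniformSpace Y] [IsUniformAddGroup Y] [ContinuousSMul ℂ Y]
    (hA : IsInvolutiveStereotypeAlgebra A)
    (hX : IsStereotypeModule A X) (hY : IsStereotypeModule A Y)
    (n : ℕ) (D : X →L[ℂ] Y) (hD : IsDiffOp A n D) :
    ∃ μ : JetBundle A X n → JetBundle A Y 0,
      IsJetBundleMorphism μ ∧ ∀ x : X, jet A 0 (D x) = μ ∘ jet A n x :=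
  mainTheorem8_general n 0 D hD
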